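/- For an integer $d\ge 1$ let $\ell_\infty^d$ be $\mathbb R^d$ with the maximum norm, let $c$ be the space of convergent real sequences and $c_0$ the space of real sequences converging to $0$, both with the supremum norm. Let $X$ be one of these spaces and $V\subseteq X$ countable and dense. A (simple, undirected) graph $G$ with vertex set $V$ is a geometric $1$-graph if (a) adjacent vertices $u,v$ satisfy $\|u-v\|<1$, and (b) for all $0<\delta'<1$, all $x\in V$ and all disjoint finite sets $A,B\subseteq V$ whose points are at distance less than $1$ from $x$, there is a vertex $z\notin A\cup B\cup\{x\}$ that is adjacent to all vertices of $A$ and to none of $B$, with $\|u-z\|<1$ for all $u\in A\cup B$ and $\|x-z\|<\delta'$. A graph is said to be of type $GR(X)$ if it is isomorphic to a geometric $1$-graph on some countable dense set $V\subseteq X$ with the following property. - $X=\ell_\infty^d$: $x_i-y_i\notin\mathbb Z$ for all distinct $x,y\in V$ and all $1\le i\le d$. - $X=c$: $x_n\notin\mathbb Z$ for all $x\in V$ and $x_n-y_n\notin\mathbb Z$ for all distinct $x,y\in V$, for all $n\in\mathbb N\cup\{\infty\}$, where $x_\infty=\lim_n x_n$. - $X=c_0$: for some $a\in(0,1)$ the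 translate $V'=V+(a,a,\dots)$ satisfies $x_n\notin\mathbb Z$ for all $x\in V'$ and $x_n-y_n\notin\mathbb Z$ for all distinct $x,y\in V'$, for all $n\in\mathbb N$, and has the independent order property: for all finitely many distinct points $x^{(1)},\dots,x^{(k)}\in V'$ and all strict total orders $\prec_1,\dots,\prec_N$ of $\{1,\dots,k\}$ there are distinct positions $j_1,\dots,j_N\in\mathbb N$ such that, for all $\ell,m,n$, $m\prec_\ell n$ if and only if the fractional part of $x^{(m)}_{j_\ell}$ is less than that of $x^{(n)}_{j_\ell}$. Then for each of the spaces $\ell_\infty^d$ ($d\ge1$), $c$ and $c_0$ there is a graph of type $GR(X)$, and if $X\ne Y$ are two different spaces of this list, then no graph of type $GR(X)$ is isomorphic to a graph of type $GR(Y)$. That is, the geometric Rado graphs $GR(\ell_\infty^d)$ for $d\ge 1$, $GR(c)$ and $GR(c_0)$ are pairwise non-isomorphic. -/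

import Mathlib

open scoped ENNReal Topology
open Filter

namespace GeomRado

/-! ### Geometric graphs in a normed space -/

section Geometric

variable {X : Type*} [NormedAddCommGroup X]

/-- `G`, a graph whose vertices are the points of `V ⊆ X`, is geometrically existentially closed at
level `δ`. -/
def IsGEC (δ : ℝ) {V : Set X} (G : SimpleGraph V) : Prop :=
  ∀ δ' : ℝ, 0 < δ' → δ' < δ → ∀ (x : V) (A B : Finset V), Disjoint A B →
    (∀ u : V, u ∈ A ∨ u ∈ B → ‖(u : X) - x‖ < δ) →
    ∃ z : V, z ∉ A ∧ z ∉ B ∧ z ≠ x ∧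
      (∀ u ∈ A, G.Adj z u) ∧ (∀ u ∈ B, ¬ G.Adj z u) ∧
      (∀ u : V, u ∈ A ∨ u ∈ B → ‖(u : X) - z‖ < δ) ∧
      ‖(x : X) - z‖ < δ'

/-- `G` has threshold `δ`: adjacent vertices are at distance less than `δ`. -/
def HasThreshold (δ : ℝ) {V : Set X} (G : SimpleGraph V) : Prop :=
  ∀ u v : V, G.Adj u v → ‖(u : X) - v‖ < δ

/-- Geometric `δ`-graphs: countable, g.e.c. at level `δ`, and of threshold `δ`. -/
def IsGeometricGraph (δ : ℝ) {V : Set X} (G : SimpleGraph V) : Prop :=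
  V.Countable ∧ IsGEC δ G ∧ HasThreshold δ G

end Geometric

/-! ### The sequence spaces -/

/-- Bounded real sequences with the supremum norm. -/
abbrev Linf : Type := lp (fun _ : ℕ => ℝ) ∞

/-- The space `c` of convergent real sequences, inside the bounded sequences. -/
def cSpace : Set Linf := {x | ∃ a : ℝ, Tendsto (fun n => x n) atTop (𝓝 a)}

/-- The space `c₀` of real sequences converging to `0`, inside the bounded sequences. -/
def c0Space : Set Linf := {x | Tendsto (fun n => x n) atTop (𝓝 0)}

/-- `V` is a dense subset of `S`. -/
def IsDenseIn {X : Type*} [TopologicalSpace X] (V S : Set X) : Prop :=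
  V ⊆ S ∧ S ⊆ closure V

/-! ### Non-integrality conditions -/

/-- The real number `t` is an integer. -/
def IsInt (t : ℝ) : Prop := ∃ m : ℤ, (m : ℝ) = t

/-- No two distinct points of `A` differ by an integer in any coordinate. -/
def DiffIntegerFree {ι : Type*} (A : Set (ι → ℝ)) : Prop :=
  ∀ x ∈ A, ∀ y ∈ A, x ≠ y → ∀ i, ¬ IsInt (x i - y i)

/-- Integer distance free sets of sequences with a common limit: no coordinate is an integer, and
no two distinct points differ by an integer in any coordinate. -/
def IDF (A : Set (ℕ → ℝ)) : Prop :=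
  (∀ x ∈ A, ∀ n, ¬ IsInt (x n)) ∧ DiffIntegerFree A

/-- Integer distance free sets of convergent sequences: the same, also for the
coordinate `x_∞ = lim x_n`. -/
def IDFWithLimit (A : Set (ℕ → ℝ)) : Prop :=
  IDF A ∧
  (∀ x ∈ A, ∀ a : ℝ, Tendsto x atTop (𝓝 a) → ¬ IsInt a) ∧
  (∀ x ∈ A, ∀ y ∈ A, x ≠ y → ∀ a b : ℝ,
    Tendsto x atTop (𝓝 a) → Tendsto y atTop (𝓝 b) → ¬ IsInt (a - b))

/-- The independent order property: for any finitely many points of `A` and any finite list of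
strict total orders on their indices, there are distinct coordinates in which the fractional parts
of the points are arranged according to these orders. -/
def IndependentOrder (A : Set (ℕ → ℝ)) : Prop :=
  ∀ (k : ℕ) (p : Fin k → ℕ → ℝ), Function.Injective p → (∀ m, p m ∈ A) →
  ∀ (N : ℕ) (r : Fin N → Fin k → Fin k → Prop), (∀ l, IsStrictTotalOrder (Fin k) (r l)) →
  ∃ j : Fin N → ℕ, Function.Injective j ∧
    ∀ l m n, r l m n ↔ Int.fract (p m (j l)) < Int.fract (p n (j l))

/-! ### The geometric Rado graphs -/

/-- The spaces under consideration: `ℓ_∞^d` for positive integers `d`, then `c`, then `c₀`. -/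
inductive Space : Type
  | ellInf (d : ℕ) (hd : 0 < d) : Space
  | c : Space
  | c0 : Space

/-- `G` is of the isomorphism type `GR(ℓ_∞^d)`; the norm on `Fin d → ℝ` is the supremum norm. -/
def IsGREllInf (d : ℕ) {α : Type*} (G : SimpleGraph α) : Prop :=
  ∃ V : Set (Fin d → ℝ), Dense V ∧ DiffIntegerFree V ∧
    ∃ H : SimpleGraph V, IsGeometricGraph 1 H ∧ Nonempty (G ≃g H)

/-- `G` is of the isomorphism type `GR(c)`. -/
def IsGRc {α : Type*} (G : SimpleGraph α) : Prop :=
  ∃ V : Set Linf, IsDenseIn V cSpace ∧ IDFWithLimit ((fun x n => x n) '' V) ∧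
    ∃ H : SimpleGraph V, IsGeometricGraph 1 H ∧ Nonempty (G ≃g H)

/-- `G` is of the isomorphism type `GR(c₀)`. The conditions are imposed on the translate of `V` by a
constant sequence `(a, a, …)` with `0 < a < 1`, a set of sequences converging to `a`. -/
def IsGRc0 {α : Type*} (G : SimpleGraph α) : Prop :=
  ∃ V : Set Linf, IsDenseIn V c0Space ∧
    (∃ a : ℝ, 0 < a ∧ a < 1 ∧
      IDF ((fun x n => x n + a) '' V) ∧ IndependentOrder ((fun x n => x n + a) '' V)) ∧
    ∃ H : SimpleGraph V, IsGeometricGraph 1 H ∧ Nonempty (G ≃g H)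

/-- `IsGR S G`: the graph `G` is (isomorphic to) the geometric Rado graph `GR(S)`. -/
def IsGR {α : Type*} (S : Space) (G : SimpleGraph α) : Prop :=
  match S with
  | .ellInf d _ => IsGREllInf d G
  | .c => IsGRc G
  | .c0 => IsGRc0 G

end GeomRado

/-! In a geometric 1-graph whose vertex set has convex closure, walks of length two and three see
the norm: they join `u` and `v` exactly when `‖u - v‖ < 2`, respectively `‖u - v‖ < 3`
(`joinedTwo_iff_norm_lt`, `joinedThree_iff_norm_lt`). Two graph invariants then separate the spaces.
Large families with all norm distances in `[2, 3)` have at most `2 ^ d` members in `ℓ_∞^d`, a bound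
attained by the corners of a cube, while `c` and `c₀` contain arbitrarily large ones because of
multiples of the unit sequences. This tells the `ℓ_∞^d` apart from one another and from `c` and
`c₀`. For `c` against `c₀`, the constant sequences of `c` give two balls of radius three that meet
only near their midpoint (`HasCentre`). In `c₀` all centres are almost zero in a late coordinate, so
a point of the intersection can still be moved far in that coordinate. For existence, a greedy
construction answers every extension request by a fresh vertex (`exists_isGeometricGraph`). The
dense sets are small perturbations of countable dense families, which avoid countably many bad
shifts. For `c₀`, the tails of the sequences moreover realise every finite order pattern
(`exists_universal_weights`). -/

namespace GeomRado

/-! ### Short walks in geometric graphs -/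

/-- `u` and `v` are joined by a walk of length two. -/
def JoinedTwo {α : Type*} (G : SimpleGraph α) (u v : α) : Prop :=
  ∃ w, G.Adj u w ∧ G.Adj w v

/-- `u` and `v` are joined by a walk of length three. -/
def JoinedThree {α : Type*} (G : SimpleGraph α) (u v : α) : Prop :=
  ∃ w, G.Adj u w ∧ JoinedTwo G w v

theorem JoinedTwo.map {α β : Type*} {G : SimpleGraph α} {H : SimpleGraph β} (f : G ≃g H)
    {u v : α} (h : JoinedTwo G u v) : JoinedTwo H (f u) (f v) := by
  obtain ⟨w, h₁, h₂⟩ := h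
  exact ⟨f w, f.map_adj_iff.2 h₁, f.map_adj_iff.2 h₂⟩

theorem JoinedThree.map {α β : Type*} {G : SimpleGraph α} {H : SimpleGraph β} (f : G ≃g H)
    {u v : α} (h : JoinedThree G u v) : JoinedThree H (f u) (f v) := by
  obtain ⟨w, h₁, h₂⟩ := h
  exact ⟨f w, f.map_adj_iff.2 h₁, h₂.map f⟩

theorem joinedTwo_iso {α β : Type*} {G : SimpleGraph α} {H : SimpleGraph β} (f : G ≃g H)
    {u v : α} : JoinedTwo H (f u) (f v) ↔ JoinedTwo G u v :=
  ⟨fun h => by simpa using h.map f.symm, fun h => h.map f⟩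

theorem joinedThree_iso {α β : Type*} {G : SimpleGraph α} {H : SimpleGraph β} (f : G ≃g H)
    {u v : α} : JoinedThree H (f u) (f v) ↔ JoinedThree G u v :=
  ⟨fun h => by simpa using h.map f.symm, fun h => h.map f⟩

/-- `G` has a family of vertices, indexed by `ι`, with pairwise distances equal to three. -/
def HasThreeEquilateral {α : Type*} (G : SimpleGraph α) (ι : Type*) : Prop :=
  ∃ f : ι → α, ∀ i j, i ≠ j → JoinedThree G (f i) (f j) ∧ ¬ JoinedTwo G (f i) (f j)

/-- Some vertex `m` lies in two balls of radius three whose intersection is contained in the ball of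
radius two around `m`. -/
def HasCentre {α : Type*} (G : SimpleGraph α) : Prop :=
  ∃ m p q, JoinedThree G m p ∧ JoinedThree G m q ∧
    ∀ x, JoinedThree G x p → JoinedThree G x q → JoinedTwo G x m

theorem HasThreeEquilateral.iso {α β : Type*} {G : SimpleGraph α} {H : SimpleGraph β}
    (f : G ≃g H) {ι : Type*} (h : HasThreeEquilateral G ι) : HasThreeEquilateral H ι := by
  obtain ⟨g, hg⟩ := h
  refine ⟨f ∘ g, fun i j hij => ?_⟩
  simpa only [Function.comp, joinedTwo_iso, joinedThree_iso] using hg i j hij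

theorem HasCentre.iso {α β : Type*} {G : SimpleGraph α} {H : SimpleGraph β}
    (f : G ≃g H) (h : HasCentre G) : HasCentre H := by
  obtain ⟨m, p, q, hp, hq, h⟩ := h
  refine ⟨f m, f p, f q, hp.map f, hq.map f, fun x hxp hxq => ?_⟩
  obtain ⟨x, rfl⟩ := f.surjective x
  rw [joinedThree_iso] at hxp hxq
  exact (h x hxp hxq).map f

section Geometric

variable {X : Type*} [NormedAddCommGroup X] [NormedSpace ℝ X] {V : Set X} {G : SimpleGraph V}

theorem exists_near_segment (hV : Convex ℝ (closure V)) (u v : V) {t ε : ℝ} (h0 : 0 ≤ t)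
    (h1 : t ≤ 1) (hε : 0 < ε) :
    ∃ x : V, ‖(u : X) - x‖ < t * ‖(u : X) - v‖ + ε ∧
      ‖(v : X) - x‖ < (1 - t) * ‖(u : X) - v‖ + ε := by
  have hmem : (1 - t) • (u : X) + t • (v : X) ∈ closure V :=
    hV (subset_closure u.2) (subset_closure v.2) (by linarith) h0 (by ring)
  obtain ⟨x, hx, hd⟩ := Metric.mem_closure_iff.1 hmem ε hε
  rw [dist_eq_norm] at hd
  refine ⟨⟨x, hx⟩, ?_, ?_⟩
  · have : (u : X) - x = t • ((u : X) - v) + ((1 - t) • (u : X) + t • (v : X) - x) := by module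
    have h := norm_add_le (t • ((u : X) - v)) ((1 - t) • (u : X) + t • (v : X) - x)
    rw [← this, norm_smul, Real.norm_of_nonneg h0] at h
    linarith
  · have : (v : X) - x = (t - 1) • ((u : X) - v) + ((1 - t) • (u : X) + t • (v : X) - x) := by
      module
    have h := norm_add_le ((t - 1) • ((u : X) - v)) ((1 - t) • (u : X) + t • (v : X) - x)
    rw [← this, norm_smul, Real.norm_of_nonpos (by linarith : t - 1 ≤ 0), neg_sub] at h
    linarith

/-- A vertex near the midpoint is within distance one of both ends, so the extension property around
it yields a common neighbour. -/
theorem joinedTwo_iff_norm_lt (hG : IsGeometricGraph 1 G) (hV : Convex ℝ (closure V)) (u v : V) :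
    JoinedTwo G u v ↔ ‖(u : X) - v‖ < 2 := by
  classical
  constructor
  · rintro ⟨w, h₁, h₂⟩
    have := norm_sub_le_norm_sub_add_norm_sub (u : X) w v
    linarith [hG.2.2 _ _ h₁, hG.2.2 _ _ h₂]
  · intro h
    obtain ⟨x, hx₁, hx₂⟩ := exists_near_segment hV u v (t := 1 / 2)
      (ε := 1 - ‖(u : X) - v‖ / 2) (by norm_num) (by norm_num) (by linarith)
    obtain ⟨z, -, -, -, hz, -⟩ := hG.2.1 (1 / 2) (by norm_num) (by norm_num) x {u, v} ∅
      (Finset.disjoint_empty_right _) (by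
        intro y hy
        simp only [Finset.mem_insert, Finset.mem_singleton, Finset.notMem_empty, or_false] at hy
        rcases hy with rfl | rfl <;> linarith)
    exact ⟨z, (hz u (by simp)).symm, hz v (by simp)⟩

theorem joinedThree_iff_norm_lt (hG : IsGeometricGraph 1 G) (hV : Convex ℝ (closure V))
    (u v : V) : JoinedThree G u v ↔ ‖(u : X) - v‖ < 3 := by
  classical
  constructor
  · rintro ⟨w, h₁, h₂⟩
    rw [joinedTwo_iff_norm_lt hG hV] at h₂
    have := norm_sub_le_norm_sub_add_norm_sub (u : X) w v
    linarith [hG.2.2 _ _ h₁]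
  · intro h
    -- The vertex `x` is near the point one third of the way from `u` to `v`. A neighbour `z` of `u`
    -- close enough to `x` is still at distance less than two from `v`.
    obtain ⟨x, hx₁, hx₂⟩ := exists_near_segment hV u v (t := 1 / 3)
      (ε := 1 - ‖(u : X) - v‖ / 3) (by norm_num) (by norm_num) (by linarith)
    have hx₃ : ‖(v : X) - x‖ < 2 := by linarith [norm_nonneg ((u : X) - v)]
    obtain ⟨δ, hδ₀, hδ⟩ := exists_between (show 0 < min 1 (2 - ‖(v : X) - x‖) by
      rw [lt_min_iff]; constructor <;> linarith)
    obtain ⟨hδ₁, hδ₂⟩ := lt_min_iff.1 hδ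
    obtain ⟨z, -, -, -, hz, -, -, hxz⟩ := hG.2.1 δ hδ₀ hδ₁ x {u} ∅
      (Finset.disjoint_empty_right _) (by
        intro y hy
        simp only [Finset.mem_singleton, Finset.notMem_empty, or_false] at hy
        subst hy; linarith)
    refine ⟨z, (hz u (by simp)).symm, (joinedTwo_iff_norm_lt hG hV z v).2 ?_⟩
    have := norm_sub_le_norm_sub_add_norm_sub (v : X) x z
    rw [norm_sub_rev]
    linarith

/-- Points of the closure whose distances are all `5 / 2` can be approximated by an equilateral
family of vertices. -/
theorem hasThreeEquilateral_of_norm_eq (hG : IsGeometricGraph 1 G) (hV : Convex ℝ (closure V))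
    {ι : Type*} (y : ι → X) (hy : ∀ i, y i ∈ closure V)
    (hd : ∀ i j, i ≠ j → ‖y i - y j‖ = 5 / 2) : HasThreeEquilateral G ι := by
  -- Since `5 / 2` is the middle of `(2, 3)`, errors of `1 / 8` at both ends keep the distance in
  -- that interval.
  choose x hx hxy using fun i => Metric.mem_closure_iff.1 (hy i) (1 / 8) (by norm_num)
  simp only [dist_eq_norm] at hxy
  refine ⟨fun i => ⟨x i, hx i⟩, fun i j hij => ?_⟩
  rw [joinedThree_iff_norm_lt hG hV, joinedTwo_iff_norm_lt hG hV]
  have h : |‖y i - y j‖ - ‖x i - x j‖| ≤ ‖(y i - x i) - (y j - x j)‖ := by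
    convert abs_norm_sub_norm_le (y i - y j) (x i - x j) using 1
    congr 1
    abel
  have h' := norm_sub_le (y i - x i) (y j - x j)
  rw [hd i j hij] at h
  have := abs_le.1 (h.trans h')
  constructor
  · linarith [hxy i, hxy j]
  · linarith [hxy i, hxy j]

end Geometric

/-! ### Equilateral families in `ℓ_∞^d` -/

/-- In each coordinate the family lies in an interval of length three. Cutting all these intervals
in half gives `2 ^ d` boxes, and two points in one box are at distance less than two. Equality comes
from the corners of a cube of side `5 / 2`. -/
theorem IsGREllInf.hasThreeEquilateral_iff {d : ℕ} {α : Type*} {G : SimpleGraph α}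
    (h : IsGREllInf d G) (N : ℕ) : HasThreeEquilateral G (Fin N) ↔ N ≤ 2 ^ d := by
  obtain ⟨V, hV, -, H, hH, ⟨e⟩⟩ := h
  have hconv : Convex ℝ (closure V) := by rw [hV.closure_eq]; exact convex_univ
  have hcard : Fintype.card (Fin d → Bool) = 2 ^ d := by simp
  constructor
  · intro h
    obtain ⟨f, hf⟩ := h.iso e
    rcases N.eq_zero_or_pos with rfl | hN
    · simp
    have : Nonempty (Fin N) := ⟨⟨0, hN⟩⟩
    choose k hk using fun j => Finite.exists_min (fun i : Fin N => (f i : Fin d → ℝ) j)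
    have hinj : Function.Injective
        (fun (i : Fin N) (j : Fin d) =>
          decide ((f i : Fin d → ℝ) j < (f (k j) : Fin d → ℝ) j + 3 / 2)) := by
      intro a b hab
      by_contra hne
      refine (hf a b hne).2 ((joinedTwo_iff_norm_lt hH hconv _ _).2 ?_)
      rw [pi_norm_lt_iff (by norm_num)]
      intro j
      have hj := congrFun hab j
      have hlt : ∀ c, (f c : Fin d → ℝ) j < (f (k j) : Fin d → ℝ) j + 3 := by
        intro c
        rcases eq_or_ne c (k j) with rfl | hc
        · linarith
        · have := (joinedThree_iff_norm_lt hH hconv _ _).1 (hf c (k j) hc).1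
          have := (norm_le_pi_norm _ j).trans_lt this
          rw [Pi.sub_apply, Real.norm_eq_abs] at this
          linarith [(abs_lt.1 this).2]
      simp only [decide_eq_decide] at hj
      rw [Pi.sub_apply, Real.norm_eq_abs, abs_lt]
      have ha := hk j a
      have hb := hk j b
      have ha' := hlt a
      have hb' := hlt b
      by_cases hc : (f a : Fin d → ℝ) j < (f (k j) : Fin d → ℝ) j + 3 / 2
      · have := hj.1 hc
        constructor <;> linarith
      · have := mt hj.2 hc
        constructor <;> linarith
    simpa [hcard] using Fintype.card_le_of_injective _ hinj
  · intro hN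
    obtain ⟨s⟩ : Nonempty (Fin N ↪ (Fin d → Bool)) :=
      Function.Embedding.nonempty_of_card_le (by simpa using hN)
    refine (hasThreeEquilateral_of_norm_eq hH hconv
      (fun i j => if s i j then (5 / 2 : ℝ) else 0)
      (fun i => hV _) fun i j hij => ?_).iso e.symm
    apply le_antisymm
    · rw [pi_norm_le_iff_of_nonneg (by norm_num)]
      intro l
      simp only [Pi.sub_apply]
      split_ifs <;> norm_num
    · obtain ⟨l, hl⟩ := Function.ne_iff.1 (s.injective.ne hij)
      refine le_trans ?_ (norm_le_pi_norm _ l)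
      simp only [Pi.sub_apply]
      cases h1 : s i l <;> cases h2 : s j l <;> simp_all

/-! ### The spaces `c` and `c₀` -/

theorem IsDenseIn.convex_closure {X : Type*} [NormedAddCommGroup X] [NormedSpace ℝ X]
    {V S : Set X} (h : IsDenseIn V S) (hS : Convex ℝ S) : Convex ℝ (closure V) := by
  rw [show closure V = closure S from
    (closure_mono h.1).antisymm (closure_minimal h.2 isClosed_closure)]
  exact hS.closure

theorem convex_cSpace : Convex ℝ cSpace := by
  rintro x ⟨a, ha⟩ y ⟨b, hb⟩ s t - - -
  exact ⟨s * a + t * b, (ha.const_mul s).add (hb.const_mul t)⟩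

theorem convex_c0Space : Convex ℝ c0Space := by
  intro x hx y hy s t _ _ _
  have := (Tendsto.const_mul s hx).add (Tendsto.const_mul t hy)
  simp only [mul_zero, add_zero] at this
  exact this

theorem c0Space_subset_cSpace : c0Space ⊆ cSpace := fun _ hx => ⟨0, hx⟩

theorem single_mem_c0Space (n : ℕ) (a : ℝ) : (lp.single ∞ n a : Linf) ∈ c0Space := by
  refine tendsto_const_nhds.congr' ?_
  filter_upwards [eventually_gt_atTop n] with k hk
  exact (lp.single_apply_ne (E := fun _ : ℕ => ℝ) ∞ n a hk.ne').symm

theorem norm_single_sub_single {m n : ℕ} (h : m ≠ n) {a : ℝ} (ha : 0 ≤ a) :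
    ‖(lp.single ∞ m a : Linf) - lp.single ∞ n a‖ = a := by
  apply le_antisymm
  · refine lp.norm_le_of_forall_le ha fun k => ?_
    rw [lp.coeFn_sub, Pi.sub_apply, lp.single_apply, lp.single_apply, Real.norm_eq_abs]
    by_cases h1 : k = m <;> by_cases h2 : k = n <;>
      simp_all [abs_of_nonneg ha]
  · refine le_trans (le_of_eq ?_)
      (lp.norm_apply_le_norm ENNReal.top_ne_zero
        ((lp.single ∞ m a : Linf) - lp.single ∞ n a) m)
    rw [lp.coeFn_sub, Pi.sub_apply, lp.single_apply_self, lp.single_apply_ne _ _ _ h, sub_zero,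
      Real.norm_of_nonneg ha]

theorem hasThreeEquilateral_of_c0Space_subset {V : Set Linf} {H : SimpleGraph V}
    (hH : IsGeometricGraph 1 H) (hV : Convex ℝ (closure V)) (h0 : c0Space ⊆ closure V) (N : ℕ) :
    HasThreeEquilateral H (Fin N) :=
  hasThreeEquilateral_of_norm_eq hH hV (fun i => lp.single ∞ (i : ℕ) (5 / 2 : ℝ))
    (fun _ => h0 (single_mem_c0Space _ _))
    fun _ _ hij => norm_single_sub_single (Fin.val_ne_of_ne hij) (by norm_num)

theorem IsGRc.hasThreeEquilateral {α : Type*} {G : SimpleGraph α} (h : IsGRc G) (N : ℕ) :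
    HasThreeEquilateral G (Fin N) := by
  obtain ⟨V, hV, -, H, hH, ⟨e⟩⟩ := h
  exact (hasThreeEquilateral_of_c0Space_subset hH (hV.convex_closure convex_cSpace)
    (c0Space_subset_cSpace.trans hV.2) N).iso e.symm

theorem IsGRc0.hasThreeEquilateral {α : Type*} {G : SimpleGraph α} (h : IsGRc0 G) (N : ℕ) :
    HasThreeEquilateral G (Fin N) := by
  obtain ⟨V, hV, -, H, hH, ⟨e⟩⟩ := h
  exact (hasThreeEquilateral_of_c0Space_subset hH (hV.convex_closure convex_c0Space) hV.2 N).iso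
    e.symm

/-- Take `m`, `p`, `q` near the constants `0`, `-5 / 2`, `5 / 2`. Being within three of `p` and `q`
forces every coordinate into about `[-1 / 2, 1 / 2]`. -/
theorem IsGRc.hasCentre {α : Type*} {G : SimpleGraph α} (h : IsGRc G) : HasCentre G := by
  obtain ⟨V, hV, -, H, hH, ⟨e⟩⟩ := h
  have hconv := hV.convex_closure convex_cSpace
  refine HasCentre.iso e.symm ?_
  have hmem : ∀ a : ℝ, a • (1 : Linf) ∈ closure V := fun a => hV.2 ⟨a, by
    simp [lp.infty_coeFn_one]⟩
  have key : ∀ a : ℝ, ∃ v : V, ∀ n, |(v : Linf) n - a| < 1 / 8 := by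
    intro a
    obtain ⟨v, hv, hd⟩ := Metric.mem_closure_iff.1 (hmem a) (1 / 8) (by norm_num)
    rw [dist_comm, dist_eq_norm] at hd
    refine ⟨⟨v, hv⟩, fun n => ?_⟩
    have := (lp.norm_apply_le_norm ENNReal.top_ne_zero _ n).trans_lt hd
    rw [lp.coeFn_sub, lp.coeFn_smul, lp.infty_coeFn_one] at this
    simpa using this
  obtain ⟨m, hm⟩ := key 0
  obtain ⟨p, hp⟩ := key (-(5 / 2))
  obtain ⟨q, hq⟩ := key (5 / 2)
  simp only [abs_lt] at hm hp hq
  refine ⟨m, p, q, ?_, ?_, fun x hxp hxq => ?_⟩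
  · refine (joinedThree_iff_norm_lt hH hconv _ _).2 (lt_of_le_of_lt
      (lp.norm_le_of_forall_le (C := 11 / 4) (by norm_num) fun n => ?_) (by norm_num))
    rw [lp.coeFn_sub, Pi.sub_apply, Real.norm_eq_abs, abs_le]
    constructor <;> linarith [hm n, hp n]
  · refine (joinedThree_iff_norm_lt hH hconv _ _).2 (lt_of_le_of_lt
      (lp.norm_le_of_forall_le (C := 11 / 4) (by norm_num) fun n => ?_) (by norm_num))
    rw [lp.coeFn_sub, Pi.sub_apply, Real.norm_eq_abs, abs_le]
    constructor <;> linarith [hm n, hq n]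
  · rw [joinedThree_iff_norm_lt hH hconv] at hxp hxq
    refine (joinedTwo_iff_norm_lt hH hconv _ _).2 (lt_of_le_of_lt
      (lp.norm_le_of_forall_le (C := 1) (by norm_num) fun n => ?_) (by norm_num))
    have h1 := (lp.norm_apply_le_norm ENNReal.top_ne_zero _ n).trans_lt hxp
    have h2 := (lp.norm_apply_le_norm ENNReal.top_ne_zero _ n).trans_lt hxq
    rw [lp.coeFn_sub, Pi.sub_apply, Real.norm_eq_abs, abs_lt] at h1 h2
    rw [lp.coeFn_sub, Pi.sub_apply, Real.norm_eq_abs, abs_le]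
    constructor <;> linarith [hm n, hp n, hq n]

/-- In a coordinate where `m`, `p` and `q` are all nearly zero, raising `m` by `5 / 2` keeps it
within three of `p` and `q` but takes it further than two from `m`. -/
theorem IsGRc0.not_hasCentre {α : Type*} {G : SimpleGraph α} (h : IsGRc0 G) :
    ¬ HasCentre G := by
  obtain ⟨V, hV, -, H, hH, ⟨e⟩⟩ := h
  have hconv := hV.convex_closure convex_c0Space
  intro hG
  obtain ⟨m, p, q, hp, hq, h⟩ := hG.iso e
  rw [joinedThree_iff_norm_lt hH hconv] at hp hq
  have hsmall : ∀ v : V, ∀ᶠ n in atTop, |(v : Linf) n| < 1 / 8 := fun v => by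
    have := (hV.1 v.2 : Tendsto _ _ _).abs
    rw [abs_zero] at this
    exact this.eventually (gt_mem_nhds (by norm_num))
  obtain ⟨n, hmn, hpn, hqn⟩ := ((hsmall m).and ((hsmall p).and (hsmall q))).exists
  have hy : (m : Linf) + lp.single ∞ n (5 / 2 : ℝ) ∈ closure V := by
    refine hV.2 ?_
    have := (hV.1 m.2 : Tendsto _ _ _).add (single_mem_c0Space n (5 / 2) : Tendsto _ _ _)
    rw [add_zero] at this
    exact this
  have hfar : ∀ r : V, ‖(m : Linf) - (r : Linf)‖ < 3 → |(r : Linf) n| < 1 / 8 →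
      ‖((m : Linf) + lp.single ∞ n (5 / 2 : ℝ)) - (r : Linf)‖ < 3 := by
    intro r hr hrn
    rw [abs_lt] at hrn hmn
    refine lt_of_le_of_lt (lp.norm_le_of_forall_le (C := max (11 / 4) ‖(m : Linf) - (r : Linf)‖)
      (le_max_of_le_left (by norm_num)) fun k => ?_) (max_lt (by norm_num) hr)
    rw [lp.coeFn_sub, lp.coeFn_add, Pi.sub_apply, Pi.add_apply]
    rcases eq_or_ne k n with rfl | hk
    · refine le_max_of_le_left ?_
      rw [lp.single_apply_self, Real.norm_eq_abs, abs_le]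
      constructor <;> linarith
    · refine le_max_of_le_right ?_
      rw [lp.single_apply_ne _ _ _ hk, add_zero]
      exact lp.norm_apply_le_norm ENNReal.top_ne_zero ((m : Linf) - (r : Linf)) k
  have hp' := hfar p hp hpn
  have hq' := hfar q hq hqn
  obtain ⟨ε, hε₀, hε⟩ := exists_between (show
    0 < min (1 / 8) (min (3 - ‖((m : Linf) + lp.single ∞ n (5 / 2 : ℝ)) - (p : Linf)‖)
      (3 - ‖((m : Linf) + lp.single ∞ n (5 / 2 : ℝ)) - (q : Linf)‖)) by
    simp only [lt_min_iff]; refine ⟨by norm_num, by linarith, by linarith⟩)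
  simp only [lt_min_iff] at hε
  obtain ⟨x, hx, hxy⟩ := Metric.mem_closure_iff.1 hy ε hε₀
  rw [dist_comm, dist_eq_norm] at hxy
  have hx2 := h ⟨x, hx⟩
    ((joinedThree_iff_norm_lt hH hconv _ _).2 (by
      have := norm_sub_le_norm_sub_add_norm_sub x ((m : Linf) + lp.single ∞ n (5 / 2 : ℝ)) p
      linarith))
    ((joinedThree_iff_norm_lt hH hconv _ _).2 (by
      have := norm_sub_le_norm_sub_add_norm_sub x ((m : Linf) + lp.single ∞ n (5 / 2 : ℝ)) q
      linarith))
  rw [joinedTwo_iff_norm_lt hH hconv] at hx2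
  have h1 := (lp.norm_apply_le_norm ENNReal.top_ne_zero _ n).trans_lt hx2
  have h2 := (lp.norm_apply_le_norm ENNReal.top_ne_zero _ n).trans_lt hxy
  rw [lp.coeFn_sub, Pi.sub_apply, Real.norm_eq_abs, abs_lt] at h1 h2
  rw [lp.coeFn_add, Pi.add_apply, lp.single_apply_self] at h2
  linarith

/-! ### Separating the spaces by the two invariants -/

theorem isEmpty_iso_of_ne {S T : Space} (hST : S ≠ T) {α β : Type*} {G : SimpleGraph α}
    {H : SimpleGraph β} (hG : IsGR S G) (hH : IsGR T H) : IsEmpty (G ≃g H) := by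
  refine ⟨fun e => ?_⟩
  have hle : ∀ {a b : ℕ}, 2 ^ a ≤ 2 ^ b → a ≤ b := fun h =>
    (Nat.pow_le_pow_iff_right (by norm_num)).1 h
  match S, T, hG, hH, hST with
  | .ellInf d hd, .ellInf d' hd', (hG : IsGREllInf d G), (hH : IsGREllInf d' H), hST =>
    have h1 := (hH.hasThreeEquilateral_iff _).1 (((hG.hasThreeEquilateral_iff _).2 le_rfl).iso e)
    have h2 :=
      (hG.hasThreeEquilateral_iff _).1 (((hH.hasThreeEquilateral_iff _).2 le_rfl).iso e.symm)
    obtain rfl := le_antisymm (hle h1) (hle h2)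
    exact hST rfl
  | .ellInf d hd, .c, (hG : IsGREllInf d G), (hH : IsGRc H), _ =>
    exact absurd ((hG.hasThreeEquilateral_iff (2 ^ d + 1)).1
      ((hH.hasThreeEquilateral _).iso e.symm)) (by lia)
  | .ellInf d hd, .c0, (hG : IsGREllInf d G), (hH : IsGRc0 H), _ =>
    exact absurd ((hG.hasThreeEquilateral_iff (2 ^ d + 1)).1
      ((hH.hasThreeEquilateral _).iso e.symm)) (by lia)
  | .c, .ellInf d hd, (hG : IsGRc G), (hH : IsGREllInf d H), _ =>
    exact absurd ((hH.hasThreeEquilateral_iff (2 ^ d + 1)).1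
      ((hG.hasThreeEquilateral _).iso e)) (by lia)
  | .c0, .ellInf d hd, (hG : IsGRc0 G), (hH : IsGREllInf d H), _ =>
    exact absurd ((hH.hasThreeEquilateral_iff (2 ^ d + 1)).1
      ((hG.hasThreeEquilateral _).iso e)) (by lia)
  | .c, .c0, (hG : IsGRc G), (hH : IsGRc0 H), _ => exact hH.not_hasCentre (hG.hasCentre.iso e)
  | .c0, .c, (hG : IsGRc0 G), (hH : IsGRc H), _ =>
    exact hG.not_hasCentre (hH.hasCentre.iso e.symm)
  | .c, .c, _, _, hST => exact hST rfl
  | .c0, .c0, _, _, hST => exact hST rfl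

/-! ### Existence of geometric graphs -/

/-- Sequences can be chosen term by term, subject to conditions on the preceding terms. -/
theorem exists_seq_of_finset_image {α : Type*} [DecidableEq α] (C : ℕ → Finset α → α → Prop)
    (h : ∀ n s, ∃ y, C n s y) :
    ∃ f : ℕ → α, ∀ n, C n ((Finset.range n).image f) (f n) := by
  choose g hg using h
  let F : ℕ → Finset α := fun n => Nat.rec ∅ (fun k s => insert (g k s) s) n
  have hF : ∀ n, (Finset.range n).image (fun k => g k (F k)) = F n := by
    intro n
    induction n with
    | zero => rfl
    | succ n ih => rw [Finset.range_add_one, Finset.image_insert, ih]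
  exact ⟨fun k => g k (F k), fun n => by rw [hF]; exact hg n _⟩

section Construction

variable {X : Type*} [NormedAddCommGroup X]

/-- Every point of `V` is the limit of points of `V` outside any given finite set. -/
def FinitelyAvoidable (V : Set X) : Prop :=
  ∀ x ∈ V, ∀ ε > 0, ∀ F : Set X, F.Finite → ∃ z ∈ V, ‖x - z‖ < ε ∧ z ∉ F

/-- The line through `x` has infinitely many points near `x`, so one of them avoids `F`. Since
removing `F` from a ball leaves an open set, points of `V` approximate it there. -/
theorem finitelyAvoidable_of_line_subset [NormedSpace ℝ X] {V : Set X} {e : X} (he : e ≠ 0)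
    (h : ∀ x ∈ V, ∀ t : ℝ, x + t • e ∈ closure V) : FinitelyAvoidable V := by
  intro x hx ε hε F hF
  have hinj : Function.Injective fun t : ℝ => x + t • e := fun s t hst =>
    smul_left_injective ℝ he (add_left_cancel hst)
  have hnhds : ∀ᶠ t : ℝ in 𝓝 0, x + t • e ∈ Metric.ball x ε := by
    have hc : ContinuousAt (fun t : ℝ => x + t • e) 0 := by fun_prop
    exact hc (by simpa using Metric.ball_mem_nhds x hε)
  obtain ⟨t, ht, htF⟩ := (infinite_of_mem_nhds (0 : ℝ) hnhds).exists_notMem_finite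
    (hF.preimage hinj.injOn)
  obtain ⟨z, hz, hzV⟩ := mem_closure_iff.1 (h x hx t) (Metric.ball x ε \ F)
    (Metric.isOpen_ball.sdiff hF.isClosed) ⟨ht, htF⟩
  refine ⟨z, hzV, ?_, hz.2⟩
  rw [← dist_eq_norm, dist_comm]
  exact hz.1

theorem FinitelyAvoidable.infinite {V : Set X} (h : FinitelyAvoidable V) (hne : V.Nonempty) :
    V.Infinite := by
  intro hf
  obtain ⟨x, hx⟩ := hne
  obtain ⟨z, hz, -, hz'⟩ := h x hx 1 one_pos V hf
  exact hz' hz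

/-- All requests `(precision, x, A, B)` are enumerated. The `n`-th is answered by a vertex `z n`
that is new to all earlier answers and to all points named in requests up to `n`. Only answers to
valid requests create edges, from `z n` to `A n`. -/
theorem exists_isGeometricGraph {V : Set X} (hc : V.Countable) (hne : V.Nonempty)
    (hV : FinitelyAvoidable V) : ∃ H : SimpleGraph V, IsGeometricGraph 1 H := by
  classical
  have := hc.to_subtype
  have := hne.to_subtype
  obtain ⟨r, hr⟩ := exists_surjective_nat (ℕ × V × Finset V × Finset V)
  let x : ℕ → V := fun n => (r n).2.1
  let A : ℕ → Finset V := fun n => (r n).2.2.1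
  let B : ℕ → Finset V := fun n => (r n).2.2.2
  let used : ℕ → Finset V := fun n =>
    (Finset.range (n + 1)).biUnion fun k => insert (x k) (A k ∪ B k)
  have mem_used : ∀ {k n u}, k ≤ n → (u = x k ∨ u ∈ A k ∨ u ∈ B k) → u ∈ used n := by
    intro k n u hk hu
    simp only [used, Finset.mem_biUnion, Finset.mem_range, Finset.mem_insert, Finset.mem_union]
    exact ⟨k, by lia, hu⟩
  let valid : ℕ → Prop := fun n => ∀ u, u ∈ A n ∨ u ∈ B n → ‖(u : X) - x n‖ < 1
  obtain ⟨z, hz⟩ := exists_seq_of_finset_image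
    (fun n s w => w ∉ s ∧ w ∉ used n ∧
      (valid n → ‖(x n : X) - w‖ < 1 / ((r n).1 + 1 : ℝ) ∧
        ∀ u, u ∈ A n ∨ u ∈ B n → ‖(u : X) - w‖ < 1)) (by
    intro n s
    obtain ⟨ε, hε, hεn, hεu⟩ : ∃ ε > 0, ε ≤ 1 / ((r n).1 + 1 : ℝ) ∧
        (valid n → ∀ u, u ∈ A n ∨ u ∈ B n → ‖(u : X) - x n‖ + ε ≤ 1) := by
      by_cases hv : valid n
      · have hmem : ∀ᶠ ε : ℝ in 𝓝[>] 0, ∀ u ∈ A n ∪ B n, ‖(u : X) - x n‖ + ε ≤ 1 := by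
          rw [eventually_all_finset]
          intro u hu
          have := hv u (Finset.mem_union.1 hu)
          filter_upwards [Ioo_mem_nhdsGT (show (0 : ℝ) < 1 - ‖(u : X) - x n‖ by linarith)]
            with ε hε
          linarith [hε.2]
        obtain ⟨ε, h1, h2⟩ := (hmem.and (Ioo_mem_nhdsGT
          (show (0 : ℝ) < 1 / ((r n).1 + 1 : ℝ) by positivity))).exists
        exact ⟨ε, h2.1, h2.2.le, fun _ u hu => h1 u (Finset.mem_union.2 hu)⟩
      · exact ⟨1 / ((r n).1 + 1 : ℝ), by positivity, le_rfl, fun h => absurd h hv⟩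
    obtain ⟨w, hwV, hw, hwF⟩ := hV (x n) (x n).2 ε hε ((s ∪ used n).image Subtype.val)
      (Finset.finite_toSet _)
    have hwF' : (⟨w, hwV⟩ : V) ∉ s ∪ used n := fun h => hwF
      (Finset.mem_coe.2 (Finset.mem_image_of_mem Subtype.val h))
    rw [Finset.mem_union, not_or] at hwF'
    refine ⟨⟨w, hwV⟩, hwF'.1, hwF'.2, fun hv => ⟨hw.trans_le hεn, fun u hu => ?_⟩⟩
    have := norm_sub_le_norm_sub_add_norm_sub (u : X) (x n) w
    linarith [hεu hv u hu])
  have hzne : ∀ {k n}, k < n → z k ≠ z n := fun {k n} hkn h => (hz n).1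
    (h ▸ Finset.mem_image_of_mem z (Finset.mem_range.2 hkn))
  have hzinj : Function.Injective z := fun k n h => by
    rcases lt_trichotomy k n with hl | hl | hl
    · exact absurd h (hzne hl)
    · exact hl
    · exact absurd h.symm (hzne hl)
  let H : SimpleGraph V :=
    { Adj := fun u v => ∃ n, valid n ∧ ((u = z n ∧ v ∈ A n) ∨ (v = z n ∧ u ∈ A n))
      symm := ⟨fun u v ⟨n, hn, h⟩ => ⟨n, hn, h.symm⟩⟩
      loopless := ⟨fun u ⟨n, _, h⟩ => by
        rcases h with ⟨rfl, h⟩ | ⟨rfl, h⟩ <;>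
          exact (hz n).2.1 (mem_used le_rfl (Or.inr (Or.inl h)))⟩ }
  refine ⟨H, hc, ?_, ?_⟩
  · intro δ hδ₀ hδ₁ x₀ A₀ B₀ hAB h₀
    obtain ⟨N, hN⟩ := exists_nat_one_div_lt hδ₀
    obtain ⟨n, hn⟩ := hr (N, x₀, A₀, B₀)
    have hxn : x n = x₀ := by simp [x, hn]
    have hAn : A n = A₀ := by simp [A, hn]
    have hBn : B n = B₀ := by simp [B, hn]
    have hrn : (r n).1 = N := by rw [hn]
    subst hxn hAn hBn
    obtain ⟨h1, h2, h3⟩ := hz n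
    obtain ⟨h4, h5⟩ := h3 h₀
    rw [hrn] at h4
    refine ⟨z n, fun h => h2 (mem_used le_rfl (Or.inr (Or.inl h))),
      fun h => h2 (mem_used le_rfl (Or.inr (Or.inr h))),
      fun h => h2 (mem_used le_rfl (Or.inl h)), fun u hu => ⟨n, h₀, Or.inl ⟨rfl, hu⟩⟩, ?_, h5,
      h4.trans hN⟩
    -- An unwanted edge from `z n` to `u ∈ B n` comes from some request `k`. If `z n` is its answer,
    -- then `k = n` and `A n` meets `B n`. If `u` is its answer, then freshness of the later of `z
    -- n` and `z k` is violated.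
    rintro u hu ⟨k, -, ⟨hk, huk⟩ | ⟨hk, hzk⟩⟩
    · obtain rfl := hzinj hk
      exact Finset.disjoint_left.1 hAB huk hu
    · subst hk
      rcases le_total k n with hkn | hkn
      · exact (hz n).2.1 (mem_used hkn (Or.inr (Or.inl hzk)))
      · exact (hz k).2.1 (mem_used hkn (Or.inr (Or.inr hu)))
  · rintro u v ⟨n, hn, ⟨rfl, h⟩ | ⟨rfl, h⟩⟩
    · rw [norm_sub_rev]
      exact ((hz n).2.2 hn).2 v (Or.inl h)
    · exact ((hz n).2.2 hn).2 u (Or.inl h)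

theorem exists_iso_isGeometricGraph {V : Set X} (hc : V.Countable) (hne : V.Nonempty)
    (hV : FinitelyAvoidable V) :
    ∃ G : SimpleGraph ℕ, ∃ H : SimpleGraph V, IsGeometricGraph 1 H ∧ Nonempty (G ≃g H) := by
  obtain ⟨H, hH⟩ := exists_isGeometricGraph hc hne hV
  have := hc.to_subtype
  have := (hV.infinite hne).to_subtype
  obtain ⟨e⟩ := nonempty_equiv_of_countable (α := ℕ) (β := V)
  exact ⟨H.comap e, H, hH, ⟨SimpleGraph.Iso.comap e H⟩⟩

end Construction

/-! ### Existence of integer distance free dense sets -/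

theorem countable_setOf_isInt_add (a : ℝ) : {t : ℝ | IsInt (a + t)}.Countable := by
  refine (Set.countable_range fun m : ℤ => (m : ℝ) - a).mono ?_
  rintro t ⟨m, hm⟩
  exact ⟨m, by simp [hm]⟩

/-- Each `t i` is chosen in an interval after the earlier ones, and only countably many values are
forbidden. -/
theorem exists_perturbation {K : Type*} [Countable K] (q : ℕ → K → ℝ) (ε : ℕ → ℝ)
    (hε : ∀ i, 0 < ε i) :
    ∃ t : ℕ → ℝ, (∀ i, 0 < t i ∧ t i < ε i) ∧ (∀ i k, ¬ IsInt (q i k + t i)) ∧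
      ∀ i j, i ≠ j → ∀ k, ¬ IsInt ((q i k + t i) - (q j k + t j)) := by
  classical
  -- The earlier choices are available only as an unindexed finite set, so each choice carries its
  -- shifted row along with the shift.
  obtain ⟨y, hy⟩ := exists_seq_of_finset_image
    (fun n (s : Finset (ℝ × (K → ℝ))) y => (0 < y.1 ∧ y.1 < ε n) ∧ (∀ k, y.2 k = q n k + y.1) ∧
      (∀ k, ¬ IsInt (y.2 k)) ∧ ∀ z ∈ s, ∀ k, ¬ IsInt (y.2 k - z.2 k)) (by
    intro n s
    have hcount : ((⋃ k, {t : ℝ | IsInt (q n k + t)}) ∪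
        ⋃ z ∈ s, ⋃ k, {t : ℝ | IsInt ((q n k - z.2 k) + t)}).Countable :=
      (Set.countable_iUnion fun k => countable_setOf_isInt_add _).union
        (s.countable_toSet.biUnion fun z _ => Set.countable_iUnion fun k =>
          countable_setOf_isInt_add _)
    obtain ⟨t, ht, ht'⟩ := (hcount.dense_compl ℝ).exists_between (hε n)
    simp only [Set.mem_compl_iff, Set.mem_union, Set.mem_iUnion, Set.mem_ofPred_eq, not_or,
      not_exists] at ht
    refine ⟨(t, fun k => q n k + t), ht', fun _ => rfl, ht.1, fun z hz k h => ht.2 z hz k ?_⟩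
    convert h using 1
    ring)
  have key : ∀ i j, j < i → ∀ k, ¬ IsInt ((q i k + (y i).1) - (q j k + (y j).1)) := by
    intro i j hij k
    rw [← (hy i).2.1, ← (hy j).2.1]
    exact (hy i).2.2.2 _ (Finset.mem_image_of_mem y (Finset.mem_range.2 hij)) k
  refine ⟨fun i => (y i).1, fun i => (hy i).1, fun i k => ?_, fun i j hij k h => ?_⟩
  · rw [← (hy i).2.1]
    exact (hy i).2.2.1 k
  · rcases hij.lt_or_gt with hl | hl
    · obtain ⟨m, hm⟩ := h
      exact key j i hl k ⟨-m, by push_cast; rw [hm]; ring⟩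
    · exact key i j hl k h

theorem IsGREllInf.exists (d : ℕ) (hd : 0 < d) : ∃ G : SimpleGraph ℕ, IsGREllInf d G := by
  obtain ⟨s, hs⟩ := exists_surjective_nat ((Fin d → ℚ) × ℕ)
  obtain ⟨t, ht, -, htd⟩ := exists_perturbation (fun i (k : Fin d) => ((s i).1 k : ℝ))
    (fun i => 1 / ((s i).2 + 1 : ℝ)) (fun i => by positivity)
  let V : Set (Fin d → ℝ) := Set.range fun i k => (s i).1 k + t i
  have hdense : Dense V := by
    intro x
    rw [Metric.mem_closure_iff]
    intro ε hε
    obtain ⟨m, hm⟩ := exists_nat_one_div_lt (half_pos hε)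
    choose q hq using fun k => exists_rat_btwn (show x k - ε / 2 < x k by linarith)
    obtain ⟨i, hi⟩ := hs (q, m)
    refine ⟨_, ⟨i, rfl⟩, ?_⟩
    rw [dist_pi_lt_iff hε]
    intro k
    have := ht i
    simp only [hi] at this
    rw [Real.dist_eq, abs_lt]
    simp only [hi]
    constructor <;> linarith [hq k]
  have : Nonempty (Fin d) := ⟨⟨0, hd⟩⟩
  obtain ⟨G, H, hH, e⟩ := exists_iso_isGeometricGraph (Set.countable_range _)
    (Set.range_nonempty _) (finitelyAvoidable_of_line_subset (V := V)
      (e := fun _ => (1 : ℝ)) (fun h => one_ne_zero (congrFun h ⟨0, hd⟩)) fun _ _ _ => hdense _)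
  refine ⟨G, V, hdense, ?_, H, hH, e⟩
  rintro _ ⟨i, rfl⟩ _ ⟨j, rfl⟩ hij k
  exact htd i j (by rintro rfl; exact hij rfl) k

/-- The bounded sequence with the given terms. -/
def ofConvergent (f : ℕ → ℝ) {a : ℝ} (h : Tendsto f atTop (𝓝 a)) : Linf :=
  ⟨f, memℓp_infty h.norm.bddAbove_range⟩

theorem ofConvergent_apply (f : ℕ → ℝ) {a : ℝ} (h : Tendsto f atTop (𝓝 a)) (n : ℕ) :
    ofConvergent f h n = f n := rfl

theorem linf_one_ne_zero : (1 : Linf) ≠ 0 := by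
  intro h
  have := congrArg (fun x : Linf => x 0) h
  simp only [lp.infty_coeFn_one, lp.coeFn_zero] at this
  exact one_ne_zero this

theorem exists_list_approx (x : ℕ → ℝ) {ε : ℝ} (hε : 0 < ε) (N : ℕ) :
    ∃ l : List ℚ, l.length = N ∧ ∀ n < N, x n - ε < (l.getD n 0 : ℚ) ∧ (l.getD n 0 : ℚ) < x n := by
  choose q hq using fun k => exists_rat_btwn (show x k - ε < x k by linarith)
  refine ⟨List.ofFn fun i : Fin N => q i, by simp, fun n hn => ?_⟩
  simpa [List.getD_eq_getElem?_getD, hn] using hq n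

/-- Eventually constant rational sequences are shifted by one constant each. Limits are then
attained at late coordinates, so the conditions on limits follow from those on coordinates. -/
theorem IsGRc.exists : ∃ G : SimpleGraph ℕ, IsGRc G := by
  obtain ⟨s, hs⟩ := exists_surjective_nat (List ℚ × ℚ × ℕ)
  let q : ℕ → ℕ → ℝ := fun i n => ((s i).1.getD n (s i).2.1 : ℚ)
  have hq : ∀ i n, (s i).1.length ≤ n → q i n = (s i).2.1 := by
    intro i n hn
    simp only [q]
    rw [List.getD_eq_default _ _ hn]
  obtain ⟨t, ht, hti, htd⟩ := exists_perturbation q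
    (fun i => 1 / ((s i).2.2 + 1 : ℝ)) (fun i => by positivity)
  have hlim : ∀ i, Tendsto (fun n => q i n + t i) atTop (𝓝 (q i (s i).1.length + t i)) := by
    intro i
    refine tendsto_const_nhds.congr' ?_
    filter_upwards [eventually_ge_atTop (s i).1.length] with n hn
    rw [hq i n hn, hq i _ le_rfl]
  let V : Set Linf := Set.range fun i => ofConvergent _ (hlim i)
  have hdense : IsDenseIn V cSpace := by
    constructor
    · rintro _ ⟨i, rfl⟩
      exact ⟨_, hlim i⟩
    · rintro x ⟨a, ha⟩
      rw [Metric.mem_closure_iff]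
      intro ε hε
      obtain ⟨m, hm⟩ := exists_nat_one_div_lt (show 0 < ε / 4 by positivity)
      obtain ⟨N, hN⟩ := Metric.tendsto_atTop.1 ha (ε / 4) (by positivity)
      obtain ⟨b, hb⟩ := exists_rat_btwn (show a - ε / 4 < a by linarith)
      obtain ⟨l, hl, hlq⟩ := exists_list_approx (fun n => x n) (show 0 < ε / 4 by positivity) N
      obtain ⟨i, hi⟩ := hs (l, b, m)
      refine ⟨_, ⟨i, rfl⟩, ?_⟩
      rw [dist_eq_norm]
      refine lt_of_le_of_lt (lp.norm_le_of_forall_le (C := 3 * ε / 4) (by positivity)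
        fun n => ?_) (by linarith)
      rw [lp.coeFn_sub, Pi.sub_apply, ofConvergent_apply, Real.norm_eq_abs, abs_le]
      have h1 := ht i
      simp only [hi] at h1
      rcases lt_or_ge n N with hn | hn
      · have h2 : q i n = (l.getD n 0 : ℚ) := by
          simp [q, hi, List.getD_eq_getElem?_getD, hl, hn]
        have h3 := hlq n hn
        rw [← h2] at h3
        constructor <;> linarith
      · have h2 := hq i n (by rw [hi, hl]; exact hn)
        rw [hi] at h2
        have h3 := hN n hn
        rw [Real.dist_eq, abs_lt] at h3
        constructor <;> linarith
  have hline : ∀ x ∈ V, ∀ r : ℝ, x + r • (1 : Linf) ∈ closure V := by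
    intro x hx r
    obtain ⟨a, ha⟩ := hdense.1 hx
    refine hdense.2 ⟨a + r, ?_⟩
    have := ha.add_const r
    refine this.congr fun n => ?_
    rw [lp.coeFn_add, lp.coeFn_smul, lp.infty_coeFn_one]
    simp
  obtain ⟨G, H, hH, e⟩ := exists_iso_isGeometricGraph (Set.countable_range _)
    (Set.range_nonempty _) (finitelyAvoidable_of_line_subset linf_one_ne_zero hline)
  refine ⟨G, V, hdense, ⟨⟨?_, ?_⟩, ?_, ?_⟩, H, hH, e⟩
  · rintro _ ⟨_, ⟨i, rfl⟩, rfl⟩ n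
    exact hti i n
  · rintro _ ⟨_, ⟨i, rfl⟩, rfl⟩ _ ⟨_, ⟨j, rfl⟩, rfl⟩ hij n
    exact htd i j (by rintro rfl; exact hij rfl) n
  · rintro _ ⟨_, ⟨i, rfl⟩, rfl⟩ a ha
    rw [tendsto_nhds_unique ha (hlim i)]
    exact hti i _
  · rintro _ ⟨_, ⟨i, rfl⟩, rfl⟩ _ ⟨_, ⟨j, rfl⟩, rfl⟩ hij a b ha hb
    have hne : i ≠ j := by rintro rfl; exact hij rfl
    rw [tendsto_nhds_unique ha (hlim i), tendsto_nhds_unique hb (hlim j)]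
    have h1 := hq i (max (s i).1.length (s j).1.length) (le_max_left _ _)
    have h2 := hq j (max (s i).1.length (s j).1.length) (le_max_right _ _)
    rw [hq i _ le_rfl, hq j _ le_rfl, ← h1, ← h2]
    exact htd i j hne _

/-! ### Order patterns in the tails of null sequences -/

/-- There is a sequence of bounded weights on `ℕ` in which any weights on finitely many numbers
are prescribed by arbitrarily late terms. -/
theorem exists_universal_weights :
    ∃ (w : ℕ → ℕ → ℕ) (M : ℕ → ℕ), (∀ n i, w n i < M n) ∧
      ∀ (k : ℕ) (i : Fin k → ℕ), Function.Injective i → ∀ (N : ℕ) (ρ : Fin N → Fin k → ℕ) (T : ℕ),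
        ∃ j : Fin N → ℕ, Function.Injective j ∧ (∀ l, T ≤ j l) ∧ ∀ l m, w (j l) (i m) = ρ l m := by
  obtain ⟨σ, hσ⟩ := exists_surjective_nat (ℕ →₀ ℕ)
  -- Row `n` depends only on the second component of `n`, so every finitely supported weight recurs
  -- infinitely often. The first component serves to make positions late and distinct.
  refine ⟨fun n => σ n.unpair.2, fun n => ((σ n.unpair.2).support.sup (σ n.unpair.2)) + 1,
    fun n i => ?_, fun k i hi N ρ T => ?_⟩
  · rw [Nat.lt_succ_iff]
    by_cases h : i ∈ (σ n.unpair.2).support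
    · exact Finset.le_sup (f := σ n.unpair.2) h
    · exact (Finsupp.notMem_support_iff.1 h).trans_le (Nat.zero_le _)
  · choose b hb using fun l => hσ (Finsupp.embDomain ⟨i, hi⟩ (Finsupp.equivFunOnFinite.symm (ρ l)))
    refine ⟨fun l => Nat.pair (T + l) (b l), fun l l' h => ?_,
      fun l => (Nat.le_add_right _ _).trans (Nat.left_le_pair _ _), fun l m => ?_⟩
    · have := (Nat.pair_eq_pair.1 h).1
      exact Fin.ext (by lia)
    · simp only [Nat.unpair_pair, hb]
      exact Finsupp.embDomain_apply_self ⟨i, hi⟩ _ m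

/-- The rank of an element is its number of predecessors. -/
theorem exists_rank {k : ℕ} (r : Fin k → Fin k → Prop) [IsStrictTotalOrder (Fin k) r] :
    ∃ ρ : Fin k → ℕ, ∀ m n, r m n → ρ m < ρ n := by
  classical
  refine ⟨fun m => (Finset.univ.filter fun n => r n m).card, fun m n h =>
    Finset.card_lt_card ⟨fun a ha => ?_, fun hsub => ?_⟩⟩
  · simp only [Finset.mem_filter, Finset.mem_univ, true_and] at ha ⊢
    exact _root_.trans ha h
  · have := hsub (show m ∈ _ by simpa using h)
    simp only [Finset.mem_filter, Finset.mem_univ, true_and] at this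
    exact irrefl m this

/-- A constant shift would spoil the limit zero, so every coordinate gets its own perturbation. Past
its head, sequence `i` has its `n`-th term in slot `w n i` of the `M n` equal slots of `(0, 1 / (n +
1))`. Hence it tends to zero, and the weights prescribe the order of the terms. -/
theorem IsGRc0.exists : ∃ G : SimpleGraph ℕ, IsGRc0 G := by
  obtain ⟨s, hs⟩ := exists_surjective_nat (List ℚ × ℕ)
  obtain ⟨w, M, hwM, hw⟩ := exists_universal_weights
  -- The head also extends to the precision parameter, padded by zeros before perturbation, so that
  -- the tail terms are small enough for the approximation.
  let E : ℕ → ℕ := fun i => max (s i).1.length ((s i).2)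
  have hM : ∀ n, (0 : ℝ) < M n := fun n => by exact_mod_cast (Nat.zero_le _).trans_lt (hwM n 0)
  let c : ℕ → ℝ := fun n => 1 / ((n + 1 : ℝ) * M n)
  have hc : ∀ n, 0 < c n := fun n => by have := hM n; positivity
  have hcM : ∀ n, M n * c n = 1 / (n + 1 : ℝ) := fun n => by
    have := hM n
    simp only [c]
    field_simp
  let lo : ℕ → ℕ → ℝ := fun i n => if n < E i then ((s i).1.getD n 0 : ℚ) else w n i * c n
  choose t ht hti htd using fun n => exists_perturbation (fun i (_ : Unit) => lo i n + 1 / 2)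
    (fun i => if n < E i then 1 / ((s i).2 + 1 : ℝ) else c n)
    (fun i => by have := hc n; split_ifs <;> positivity)
  let x : ℕ → ℕ → ℝ := fun i n => lo i n + t n i
  have hhead : ∀ i n, n < E i → ((s i).1.getD n 0 : ℚ) < x i n ∧
      x i n < ((s i).1.getD n 0 : ℚ) + 1 / ((s i).2 + 1 : ℝ) := by
    intro i n hn
    have := ht n i
    simp only [x, lo, if_pos hn] at this ⊢
    constructor <;> linarith
  have htail : ∀ i n, E i ≤ n → w n i * c n < x i n ∧ x i n < (w n i + 1) * c n := by
    intro i n hn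
    have := ht n i
    simp only [x, lo, if_neg hn.not_gt] at this ⊢
    constructor <;> linarith
  have hsmall : ∀ i n, E i ≤ n → 0 < x i n ∧ x i n < 1 / (n + 1 : ℝ) := by
    intro i n hn
    obtain ⟨h1, h2⟩ := htail i n hn
    refine ⟨lt_of_le_of_lt (by have := hc n; positivity) h1, h2.trans_le ?_⟩
    rw [← hcM n]
    exact mul_le_mul_of_nonneg_right (by exact_mod_cast hwM n i) (hc n).le
  have hlim : ∀ i, Tendsto (x i) atTop (𝓝 0) := by
    intro i
    refine squeeze_zero_norm' ?_ tendsto_one_div_add_atTop_nhds_zero_nat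
    filter_upwards [eventually_ge_atTop (E i)] with n hn
    rw [Real.norm_of_nonneg (hsmall i n hn).1.le]
    exact (hsmall i n hn).2.le
  let V : Set Linf := Set.range fun i => ofConvergent _ (hlim i)
  have hdense : IsDenseIn V c0Space := by
    constructor
    · rintro _ ⟨i, rfl⟩
      exact hlim i
    · intro y hy
      rw [Metric.mem_closure_iff]
      intro ε hε
      obtain ⟨m, hm⟩ := exists_nat_one_div_lt (show 0 < ε / 4 by positivity)
      obtain ⟨N, hN⟩ := Metric.tendsto_atTop.1 (hy : Tendsto _ _ _) (ε / 4) (by positivity)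
      obtain ⟨l, hl, hlq⟩ := exists_list_approx (fun n => y n) (show 0 < ε / 4 by positivity) N
      obtain ⟨i, hi⟩ := hs (l, m)
      have hE : E i = max N m := by simp [E, hi, hl]
      refine ⟨_, ⟨i, rfl⟩, ?_⟩
      rw [dist_eq_norm]
      refine lt_of_le_of_lt (lp.norm_le_of_forall_le (C := 3 * ε / 4) (by positivity)
        fun n => ?_) (by linarith)
      rw [lp.coeFn_sub, Pi.sub_apply, ofConvergent_apply, Real.norm_eq_abs, abs_le]
      rcases lt_or_ge n (E i) with hn | hn
      · have h1 := hhead i n hn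
        simp only [hi] at h1
        rcases lt_or_ge n N with hnN | hnN
        · have h3 := hlq n hnN
          constructor <;> linarith
        · rw [List.getD_eq_default _ _ (hl.trans_le hnN), Rat.cast_zero] at h1
          have h3 := hN n hnN
          rw [Real.dist_eq, abs_lt] at h3
          constructor <;> linarith
      · have h1 := hsmall i n hn
        rw [hE, max_le_iff] at hn
        have h2 : 1 / (n + 1 : ℝ) ≤ 1 / (m + 1 : ℝ) :=
          one_div_le_one_div_of_le (by positivity) (by exact_mod_cast Nat.succ_le_succ hn.2)
        have h3 := hN n hn.1
        rw [Real.dist_eq, abs_lt] at h3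
        constructor <;> linarith
  have hline : ∀ y ∈ V, ∀ r : ℝ, y + r • (lp.single ∞ 0 (1 : ℝ) : Linf) ∈ closure V := by
    intro y hy r
    refine hdense.2 ?_
    have := (hdense.1 hy : Tendsto _ _ _).add
      ((single_mem_c0Space 0 1 : Tendsto _ _ _).const_mul r)
    rw [mul_zero, add_zero] at this
    exact this
  have hne : (lp.single ∞ 0 (1 : ℝ) : Linf) ≠ 0 := by
    intro h
    have := congrArg (fun x : Linf => x 0) h
    simp only [lp.single_apply_self, lp.coeFn_zero] at this
    exact one_ne_zero this
  obtain ⟨G, H, hH, e⟩ := exists_iso_isGeometricGraph (Set.countable_range _)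
    (Set.range_nonempty _) (finitelyAvoidable_of_line_subset hne hline)
  have hx : ∀ i n, x i n + 1 / 2 = lo i n + 1 / 2 + t n i := fun i n => by simp only [x]; ring
  refine ⟨G, V, hdense, ⟨1 / 2, by norm_num, by norm_num, ⟨?_, ?_⟩, ?_⟩, H, hH, e⟩
  · rintro _ ⟨_, ⟨i, rfl⟩, rfl⟩ n
    simp only [ofConvergent_apply, hx]
    exact hti n i ()
  · rintro _ ⟨_, ⟨i, rfl⟩, rfl⟩ _ ⟨_, ⟨j, rfl⟩, rfl⟩ hij n
    simp only [ofConvergent_apply, hx]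
    exact htd n i j (by rintro rfl; exact hij rfl) ()
  · intro k p hp hpV N r hr
    choose v hvV hv using hpV
    choose i hi using hvV
    have hpi : ∀ m n, p m n = x (i m) n + 1 / 2 := fun m n => by
      rw [← hv, ← hi]
      rfl
    have hinj : Function.Injective i := fun a b hab => hp (by ext n; rw [hpi, hpi, hab])
    choose ρ hρ using fun l => exists_rank (r l)
    -- The positions lie past all heads, and the `+ 2` makes the terms less than `1 / 2`, so that
    -- adding the translation `1 / 2` stays below one and fractional parts are the values
    -- themselves.
    obtain ⟨j, hj, hjT, hjw⟩ := hw k i hinj N ρ (Finset.univ.sup (fun m => E (i m)) + 2)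
    refine ⟨j, hj, fun l m n => ?_⟩
    have hE : ∀ m, E (i m) ≤ j l := fun m =>
      (Finset.le_sup (f := fun m => E (i m)) (Finset.mem_univ m)).trans (by have := hjT l; lia)
    have hfract : ∀ m, Int.fract (p m (j l)) = x (i m) (j l) + 1 / 2 := by
      intro m
      rw [hpi, Int.fract_eq_self]
      obtain ⟨h1, h2⟩ := hsmall (i m) (j l) (hE m)
      have h3 : 1 / ((j l : ℝ) + 1) ≤ 1 / 2 :=
        one_div_le_one_div_of_le (by norm_num)
          (by exact_mod_cast (show 2 ≤ j l + 1 by have := hjT l; lia))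
      constructor <;> linarith
    have hlt : ∀ m n, r l m n → x (i m) (j l) < x (i n) (j l) := by
      intro m n hmn
      have h1 := (htail (i m) (j l) (hE m)).2
      have h2 := (htail (i n) (j l) (hE n)).1
      rw [hjw] at h1 h2
      refine h1.trans_le (le_trans ?_ h2.le)
      exact mul_le_mul_of_nonneg_right (by exact_mod_cast hρ l m n hmn) (hc _).le
    rw [hfract, hfract, add_lt_add_iff_right]
    refine ⟨hlt m n, fun h => ?_⟩
    rcases trichotomous_of (r l) m n with h' | rfl | h'
    · exact h'
    · exact absurd h (lt_irrefl _)
    · exact absurd (h.trans (hlt n m h')) (lt_irrefl _)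

end GeomRado

/-- The geometric Rado graphs `GR(ℓ_∞^d)` for `d ≥ 1`, `GR(c)` and `GR(c₀)` exist, and those of
different spaces are not isomorphic. -/
theorem corollary5 :
    (∀ S : GeomRado.Space, ∃ G : SimpleGraph ℕ, GeomRado.IsGR S G) ∧
    (∀ S T : GeomRado.Space, S ≠ T →
      ∀ (α : Type*) (β : Type*) (G : SimpleGraph α) (H : SimpleGraph β),
        GeomRado.IsGR S G → GeomRado.IsGR T H → IsEmpty (G ≃g H)) := by
  refine ⟨fun S => ?_, fun S T hST α β G H hG hH => GeomRado.isEmpty_iso_of_ne hST hG hH⟩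
  cases S with
  | ellInf d hd => exact GeomRado.IsGREllInf.exists d hd
  | c => exact GeomRado.IsGRc.exists
  | c0 => exact GeomRado.IsGRc0.exists
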